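/- All graphs are finite and simple. A graph is claw-free if it has no induced subgraph isomorphic to $K_{1,3}$, and cubic if every vertex has degree $3$. The independence number $\alpha(G)$ is the maximum cardinality of a set of pairwise non-adjacent vertices of $G$; the domination number $\gamma(G)$ is the minimum cardinality of a set $D \subseteq V(G)$ such that every vertex of $V(G) \setminus D$ has a neighbor in $D$. For an integer $k \ge 1$, the triangle-necklace $F_{2k}$ is the graph obtained from $2k$ disjoint triangles $T_1, \dots, T_{2k}$, where $V(T_j) = \{x_j, y_j, z_j\}$, by adding the edges $x_{2i-1}x_{2i}$, $y_{2i-1}y_{2i}$ and $z_{2i}z_{2i+1}$ for all $i \in \{1, \dots, k\}$, with indices taken modulo $2k$ (so $z_{2k+1} = z_1$). **Theorem.** If $G$ is a connected, claw-free, cubic graph, then $\gamma(G) \le \alpha(G)$. Moreover, $\gamma(G) = \alpha(G)$ if and only if $G$ is isomorphic to $K_4$ or to $F_{2k}$ for some integer $k \ge 1$. -/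

import Mathlib

namespace ClawFreeCubic

/-- A claw-free graph: `G` has no induced subgraph isomorphic to `K_{1,3}`. -/
def ClawFree {V : Type*} (G : SimpleGraph V) : Prop :=
  ¬ (completeBipartiteGraph (Fin 1) (Fin 3)).IsIndContained G

/-- `D` is a dominating set: every vertex outside `D` has a neighbor in `D`. -/
def IsDominatingSet {V : Type*} (G : SimpleGraph V) (D : Finset V) : Prop :=
  ∀ v, v ∉ D → ∃ u ∈ D, G.Adj v u

/-- The domination number `γ(G)` of a finite graph: the least cardinality of a dominating set
(the set of these cardinalities is nonempty, as the whole vertex set is dominating). -/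
noncomputable def dominationNumber {V : Type*} [Fintype V] (G : SimpleGraph V) : ℕ :=
  sInf {n : ℕ | ∃ D : Finset V, IsDominatingSet G D ∧ D.card = n}

/-- The edges of the triangle-necklace, in one orientation. The triangles are indexed by
`ZMod k × Bool`: for `i = 1, …, k` (read modulo `k`) the pair `(i, false)` stands for `T_{2i-1}`
and `(i, true)` for `T_{2i}`, so that `T_{2i+1}` is `(i + 1, false)`. The vertices `x, y, z` of a
triangle are labelled `0, 1, 2`. -/
inductive NecklaceRel (k : ℕ) : ZMod k × Bool × Fin 3 → ZMod k × Bool × Fin 3 → Prop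
  | triangle (i : ZMod k) (b : Bool) (c d : Fin 3) (h : c ≠ d) : NecklaceRel k (i, b, c) (i, b, d)
  | edge_a (i : ZMod k) : NecklaceRel k (i, false, 0) (i, true, 0)
  | edge_b (i : ZMod k) : NecklaceRel k (i, false, 1) (i, true, 1)
  | edge_c (i : ZMod k) : NecklaceRel k (i, true, 2) (i + 1, false, 2)

/-- The triangle-necklace `F_{2k}` with `2k` triangles, for `k ≥ 1`. -/
def triangleNecklace (k : ℕ) : SimpleGraph (ZMod k × Bool × Fin 3) :=
  SimpleGraph.fromRel (NecklaceRel k)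

end ClawFreeCubic

namespace ClawFreeCubic

open Finset

/-! A maximal independent set dominates, so γ ≤ α in every graph; the content is the equality case.
In K₄ it is immediate. In a necklace, the triangles bound independent sets by 2k, and every
dominating set needs two vertices in each pair T_{2i-1}, T_{2i}
(`dominationNumber_eq_of_iso_triangleNecklace`).

Conversely, if γ = α, then no dominating set is smaller than an independent set, and each unwanted
configuration is refuted by exhibiting such a pair. A diamond is excluded by a local exchange around
a common independent set J: its two tips extend J to an independent set, while one central vertex
already makes J dominating (`dominationNumber_ne_of_diamond`). So, unless G is K₄, the vertices
split into triangles joined by a perfect matching σ (`exists_trianglePartition`).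

Hall's theorem then gives an independent set meeting every triangle (`exists_indep`). If the three
matching edges at some triangle T led to three different triangles, their outer ends would extend to
an independent dominating set avoiding T, which is too small. Hence every triangle sends two edges
to a common triangle (`exists_double`). Either some two triangles share three edges and G is the
prism F₂, or the double connections pair up the triangles and the remaining matching edges link
these pairs in a cycle (`exists_iso_of_double`). -/

/-- A nonempty set of vertices of a connected graph that is closed under adjacency is everything. -/
lemma mem_of_connected {V : Type*} {G : SimpleGraph V} (hG : G.Connected) {S : Set V} {v : V} (hv : v ∈ S)
    (hS : ∀ a ∈ S, ∀ b, G.Adj a b → b ∈ S) (w : V) : w ∈ S := by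
  obtain ⟨p⟩ := hG.preconnected v w
  induction p with
  | nil => exact hv
  | cons h _ ih => exact ih (hS _ hv _ h)

/-! ### Maximal independent sets and γ ≤ α -/

section Basic

variable {V : Type*} [Fintype V] {G : SimpleGraph V}

lemma dominationNumber_le {D : Finset V} (hD : IsDominatingSet G D) :
    dominationNumber G ≤ D.card :=
  Nat.sInf_le ⟨D, hD, rfl⟩

lemma exists_card_eq_dominationNumber (G : SimpleGraph V) :
    ∃ D : Finset V, IsDominatingSet G D ∧ D.card = dominationNumber G :=
  Nat.sInf_mem (s := {n : ℕ | ∃ D : Finset V, IsDominatingSet G D ∧ D.card = n})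
    ⟨_, Finset.univ, fun v hv => absurd (Finset.mem_univ v) hv, rfl⟩

/-- An independent subset of `P` extends to a maximal one. -/
lemma exists_maximal_indep {S P : Finset V} (hSP : S ⊆ P)
    (hS : ∀ u ∈ S, ∀ v ∈ S, ¬ G.Adj u v) :
    ∃ J : Finset V, S ⊆ J ∧ J ⊆ P ∧ (∀ u ∈ J, ∀ v ∈ J, ¬ G.Adj u v) ∧
      ∀ v ∈ P, v ∉ J → ∃ u ∈ J, G.Adj v u := by
  classical
  obtain ⟨J, hSJ, hJ⟩ := (Set.toFinite {J : Finset V | J ⊆ P ∧ ∀ u ∈ J, ∀ v ∈ J, ¬ G.Adj u v}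
    ).exists_le_maximal (a := S) ⟨hSP, hS⟩
  refine ⟨J, hSJ, hJ.prop.1, hJ.prop.2, fun v hv hvJ => ?_⟩
  by_contra! hcon
  have hle : insert v J ⊆ J := hJ.le_of_ge (y := insert v J) (by
    refine ⟨Finset.insert_subset hv hJ.prop.1, fun a ha b hb => ?_⟩
    rcases Finset.mem_insert.1 ha with rfl | ha' <;> rcases Finset.mem_insert.1 hb with rfl | hb'
    · exact G.irrefl
    · exact hcon b hb'
    · exact fun h => hcon a ha' h.symm
    · exact hJ.prop.2 a ha' b hb') (Finset.subset_insert v J)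
  exact hvJ (hle (Finset.mem_insert_self v J))

lemma dominationNumber_le_indepNum (G : SimpleGraph V) : dominationNumber G ≤ G.indepNum := by
  obtain ⟨J, -, -, hJ, hdom⟩ := exists_maximal_indep (G := G) (S := ∅) (P := Finset.univ)
    (by simp) (by simp)
  refine (dominationNumber_le fun v hv => hdom v (Finset.mem_univ v) hv).trans ?_
  exact SimpleGraph.IsIndepSet.card_le_indepNum fun a ha b hb _ => hJ a ha b hb

lemma dominationNumber_eq_indepNum (h : ∀ D I : Finset V, IsDominatingSet G D →
    G.IsIndepSet I → I.card ≤ D.card) : dominationNumber G = G.indepNum := by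
  refine (dominationNumber_le_indepNum G).antisymm ?_
  obtain ⟨D, hD, hcard⟩ := exists_card_eq_dominationNumber G
  obtain ⟨I, hI⟩ := G.exists_isNIndepSet_indepNum
  rw [← hcard, ← hI.card_eq]
  exact h D I hD hI.isIndepSet

/-- The form in which γ = α is used: a dominating set smaller than some independent set is a
contradiction. -/
lemma card_le_card_of_dominationNumber_eq (h : dominationNumber G = G.indepNum)
    {D I : Finset V} (hD : IsDominatingSet G D) (hI : ∀ u ∈ I, ∀ v ∈ I, ¬ G.Adj u v) :
    I.card ≤ D.card :=
  calc I.card ≤ G.indepNum :=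
        SimpleGraph.IsIndepSet.card_le_indepNum fun a ha b hb _ => hI a ha b hb
    _ ≤ D.card := h ▸ dominationNumber_le hD

end Basic

/-! ### Equality for K₄ and the necklaces -/

section Extremal

variable {V : Type*} [Fintype V] {G : SimpleGraph V}

lemma dominationNumber_eq_of_iso_complete (e : G ≃g SimpleGraph.completeGraph (Fin 4)) :
    dominationNumber G = G.indepNum := by
  refine dominationNumber_eq_indepNum fun D I hD hI => ?_
  have hI1 : I.card ≤ 1 := by
    refine Finset.card_le_one.2 fun a ha b hb => ?_
    by_contra hab
    exact hI ha hb hab (e.map_adj_iff.1 (by simpa using hab))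
  have hD1 : 0 < D.card := by
    refine Finset.card_pos.2 ?_
    by_contra hne
    rw [Finset.not_nonempty_iff_eq_empty] at hne
    subst hne
    obtain ⟨u, hu, -⟩ := hD (e.symm 0) (by simp)
    simp at hu
  omega

lemma triangleNecklace_adj_same {k : ℕ} {i : ZMod k} {b : Bool} {c d : Fin 3} (h : c ≠ d) :
    (triangleNecklace k).Adj (i, b, c) (i, b, d) := by
  rw [triangleNecklace, SimpleGraph.fromRel_adj]
  exact ⟨by simpa using h, .inl (.triangle i b c d h)⟩

/-- Only edges between vertices labelled 2 leave a pair of triangles, so the other four vertices of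
the pair must be dominated from within it. -/
lemma eq_of_triangleNecklace_adj {k : ℕ} {i : ZMod k} {b : Bool} {c : Fin 3} (hc : c ≠ 2)
    {w : ZMod k × Bool × Fin 3} (h : (triangleNecklace k).Adj (i, b, c) w) :
    w.1 = i ∧ (w.2.1 = b ∨ w.2.2 = c) := by
  rw [triangleNecklace, SimpleGraph.fromRel_adj] at h
  obtain ⟨-, h | h⟩ := h <;> cases h <;> simp_all

lemma dominationNumber_eq_of_iso_triangleNecklace {k : ℕ} (hk : 1 ≤ k)
    (e : G ≃g triangleNecklace k) : dominationNumber G = G.indepNum := by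
  classical
  have : NeZero k := ⟨by omega⟩
  refine dominationNumber_eq_indepNum fun D I hD hI => ?_
  have hI' : I.card ≤ 2 * k := by
    have : I.card ≤ (Finset.univ : Finset (ZMod k × Bool)).card := by
      refine Finset.card_le_card_of_injOn (fun v => ((e v).1, (e v).2.1)) (by simp) ?_
      intro a ha a' hb hab
      by_contra hne
      refine hI ha hb hne (e.map_adj_iff.1 ?_)
      have hne' : e a ≠ e a' := fun h => hne (e.injective h)
      simp only at hab
      generalize e a = x at hab hne' ⊢
      generalize e a' = y at hab hne' ⊢
      obtain ⟨i, b, c⟩ := x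
      obtain ⟨j, b', d⟩ := y
      simp only [Prod.mk.injEq] at hab
      obtain ⟨rfl, rfl⟩ := hab
      exact triangleNecklace_adj_same fun h => hne' (by rw [h])
    simpa [ZMod.card, mul_comm] using this
  refine hI'.trans ?_
  have hdom : ∀ (i : ZMod k) (b : Bool) (c : Fin 3), c ≠ 2 →
      ∃ u ∈ D, (e u).1 = i ∧ ((e u).2.1 = b ∨ (e u).2.2 = c) := by
    intro i b c hc
    by_cases hmem : e.symm (i, b, c) ∈ D
    · exact ⟨_, hmem, by simp⟩
    · obtain ⟨u, hu, hadj⟩ := hD _ hmem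
      refine ⟨u, hu, eq_of_triangleNecklace_adj hc ?_⟩
      have := e.map_adj_iff.2 hadj
      simpa using this
  have hfib : ∀ i ∈ (Finset.univ : Finset (ZMod k)), 2 ≤ (D.filter fun u => (e u).1 = i).card := by
    intro i _
    -- A single `u` cannot suffice: it fails to dominate the vertex of the other triangle whose
    -- label `c`, 0 or 1, differs from its own.
    obtain ⟨u, hu, hui, -⟩ := hdom i false 0 (by decide)
    obtain ⟨c, hc2, hc⟩ : ∃ c : Fin 3, c ≠ 2 ∧ (e u).2.2 ≠ c := by
      generalize (e u).2.2 = d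
      revert d
      decide
    obtain ⟨w, hw, hwi, hwb⟩ := hdom i (!(e u).2.1) c hc2
    refine Finset.one_lt_card.2 ⟨u, by simp [hu, hui], w, by simp [hw, hwi], ?_⟩
    rintro rfl
    rcases hwb with h | h
    · simp at h
    · exact hc h
  have := Finset.card_nsmul_le_sum _ _ _ hfib
  rw [← Finset.card_eq_sum_card_fiberwise (fun x _ => Finset.mem_coe.2 (Finset.mem_univ _))] at this
  simpa [ZMod.card, mul_comm] using this

end Extremal

/-! ### Neighborhoods in claw-free cubic graphs -/

section Local

variable {V : Type*} {G : SimpleGraph V}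

lemma ClawFree.exists_adj (hG : ClawFree G) {v a b c : V} (hab : a ≠ b) (hac : a ≠ c) (hbc : b ≠ c)
    (ha : G.Adj v a) (hb : G.Adj v b) (hc : G.Adj v c) : G.Adj a b ∨ G.Adj a c ∨ G.Adj b c := by
  by_contra! h
  obtain ⟨h1, h2, h3⟩ := h
  refine hG ⟨⟨⟨Sum.elim (fun _ => v) ![a, b, c], ?_⟩, ?_⟩⟩
  · rintro (i | i) (j | j) hij
    · rw [Subsingleton.elim i j]
    · fin_cases j <;> simp at hij <;> subst hij <;> simp_all
    · fin_cases i <;> simp at hij <;> subst hij <;> simp_all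
    · fin_cases i <;> fin_cases j <;> simp_all
  · rintro (i | i) (j | j)
    · change G.Adj v v ↔ _
      simp
    · change G.Adj v (![a, b, c] j) ↔ _
      fin_cases j <;> simp [ha, hb, hc]
    · change G.Adj (![a, b, c] i) v ↔ _
      fin_cases i <;> simp [ha.symm, hb.symm, hc.symm]
    · change G.Adj (![a, b, c] i) (![a, b, c] j) ↔ _
      fin_cases i <;> fin_cases j <;>
        simp [h1, h2, h3, G.adj_comm b a, G.adj_comm c a, G.adj_comm c b]

variable [Fintype V]

lemma exists_neighbors [DecidableRel G.Adj] (hcubic : G.IsRegularOfDegree 3) (v : V) :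
    ∃ a b c, a ≠ b ∧ a ≠ c ∧ b ≠ c ∧ ∀ u, G.Adj v u ↔ u = a ∨ u = b ∨ u = c := by
  classical
  have h := hcubic v
  rw [← SimpleGraph.card_neighborFinset_eq_degree, Finset.card_eq_three] at h
  obtain ⟨a, b, c, hab, hac, hbc, h⟩ := h
  refine ⟨a, b, c, hab, hac, hbc, fun u => ?_⟩
  rw [← SimpleGraph.mem_neighborFinset, h]
  simp

/-- In a claw-free cubic graph two of the three neighbors of a vertex are adjacent. -/
lemma exists_neighbors_adj [DecidableRel G.Adj] (hcubic : G.IsRegularOfDegree 3) (hG : ClawFree G)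
    (v : V) : ∃ a b c, a ≠ b ∧ a ≠ c ∧ b ≠ c ∧ G.Adj a b ∧
      ∀ u, G.Adj v u ↔ u = a ∨ u = b ∨ u = c := by
  obtain ⟨a, b, c, hab, hac, hbc, h⟩ := exists_neighbors hcubic v
  rcases hG.exists_adj hab hac hbc ((h a).2 (by simp)) ((h b).2 (by simp)) ((h c).2 (by simp))
    with h1 | h1 | h1
  · exact ⟨a, b, c, hab, hac, hbc, h1, h⟩
  · exact ⟨a, c, b, hac, hab, hbc.symm, h1, fun u => by rw [h]; tauto⟩
  · exact ⟨b, c, a, hbc, hab.symm, hac.symm, h1, fun u => by rw [h]; tauto⟩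

/-- The neighborhood of `v` is determined by three distinct neighbors. -/
lemma adj_iff_of_three [DecidableRel G.Adj] (hcubic : G.IsRegularOfDegree 3) {v a b c : V}
    (hab : a ≠ b) (hac : a ≠ c) (hbc : b ≠ c) (ha : G.Adj v a) (hb : G.Adj v b) (hc : G.Adj v c)
    (u : V) : G.Adj v u ↔ u = a ∨ u = b ∨ u = c := by
  obtain ⟨x, y, z, hxy, hxz, hyz, h⟩ := exists_neighbors hcubic v
  rw [h] at *
  grind

lemma adj_iff_of_two [DecidableRel G.Adj] (hcubic : G.IsRegularOfDegree 3) {v a b : V}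
    (hab : a ≠ b) (ha : G.Adj v a) (hb : G.Adj v b) :
    ∃ c, c ≠ a ∧ c ≠ b ∧ ∀ u, G.Adj v u ↔ u = a ∨ u = b ∨ u = c := by
  obtain ⟨x, y, z, hxy, hxz, hyz, h⟩ := exists_neighbors hcubic v
  rw [h] at ha hb
  rcases ha with rfl | rfl | rfl <;> rcases hb with rfl | rfl | rfl
  · exact absurd rfl hab
  · exact ⟨z, hxz.symm, hyz.symm, h⟩
  · exact ⟨y, hxy.symm, hyz, fun u => by rw [h]; tauto⟩
  · exact ⟨z, hyz.symm, hxz.symm, fun u => by rw [h]; tauto⟩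
  · exact absurd rfl hab
  · exact ⟨x, hxy, hxz, fun u => by rw [h]; tauto⟩
  · exact ⟨y, hyz, hxy.symm, fun u => by rw [h]; tauto⟩
  · exact ⟨x, hxz, hxy, fun u => by rw [h]; tauto⟩
  · exact absurd rfl hab

/-- Four mutually adjacent vertices already use up their degrees, so they are closed under adjacency
and exhaust the connected graph. -/
lemma iso_complete_of_adj [DecidableRel G.Adj] (hconn : G.Connected)
    (hcubic : G.IsRegularOfDegree 3) {v a b c : V} (hva : G.Adj v a) (hvb : G.Adj v b)
    (hvc : G.Adj v c) (hab : G.Adj a b) (hac : G.Adj a c) (hbc : G.Adj b c) :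
    Nonempty (G ≃g SimpleGraph.completeGraph (Fin 4)) := by
  classical
  have hv := adj_iff_of_three hcubic hab.ne hac.ne hbc.ne hva hvb hvc
  have ha := adj_iff_of_three hcubic hvb.ne hvc.ne hbc.ne hva.symm hab hac
  have hb := adj_iff_of_three hcubic hva.ne hvc.ne hac.ne hvb.symm hab.symm hbc
  have hc := adj_iff_of_three hcubic hva.ne hvb.ne hab.ne hvc.symm hac.symm hbc.symm
  have hall : ∀ w : V, w ∈ ({v, a, b, c} : Set V) := by
    refine mem_of_connected hconn (v := v) (by simp) ?_
    intro x hx y hxy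
    simp only [Set.mem_insert_iff, Set.mem_singleton_iff] at hx ⊢
    rcases hx with rfl | rfl | rfl | rfl
    · rw [hv] at hxy; tauto
    · rw [ha] at hxy; tauto
    · rw [hb] at hxy; tauto
    · rw [hc] at hxy; tauto
  have htop : ∀ x y, G.Adj x y ↔ x ≠ y := by
    refine fun x y => ⟨fun h => h.ne, fun h => ?_⟩
    have hx := hall x
    have hy := hall y
    simp only [Set.mem_insert_iff, Set.mem_singleton_iff] at hx hy
    rcases hx with rfl | rfl | rfl | rfl
    · rw [hv]; tauto
    · rw [ha]; tauto
    · rw [hb]; tauto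
    · rw [hc]; tauto
  have hcard : Fintype.card V = 4 := by
    have : (Finset.univ : Finset V) = {v, a, b, c} := by
      ext w
      simpa using hall w
    rw [← Finset.card_univ, this,
      Finset.card_insert_of_notMem (by simp [hva.ne, hvb.ne, hvc.ne]),
      Finset.card_eq_three.2 ⟨a, b, c, hab.ne, hac.ne, hbc.ne, rfl⟩]
  refine ⟨⟨Fintype.equivFinOfCardEq hcard, ?_⟩⟩
  intro x y
  simp [htop]

end Local

/-! ### Excluding diamonds -/

section Diamond

variable {V : Type*} [Fintype V] {G : SimpleGraph V}

/-- Exchange in a diamond: if some nonadjacent (or equal) `p`, `r` dominate the outer neighbors of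
the two tips `a`, `d`, then the tips can be traded for the single central vertex `b`. -/
lemma dominationNumber_ne_of_exchange {a b c d a' d' p r : V} (hne : a ≠ d) (hda : ¬ G.Adj a d)
    (hab : G.Adj a b) (hdb : G.Adj d b) (hbc : G.Adj b c)
    (ha : ∀ u, G.Adj a u → u = b ∨ u = c ∨ u = a') (hd : ∀ u, G.Adj d u → u = b ∨ u = c ∨ u = d')
    (hp : G.Adj a' p) (hr : G.Adj d' r) (hpr : ¬ G.Adj p r)
    (hpU : p ∉ ({a, b, c, d, a', d'} : Set V)) (hrU : r ∉ ({a, b, c, d, a', d'} : Set V)) :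
    dominationNumber G ≠ G.indepNum := by
  classical
  intro hγ
  -- `J` will be maximal independent off the six listed vertices. Adding `b` makes it dominating,
  -- with `p`, `r` taking care of `a'`, `d'`; adding `a` and `d` keeps it independent.
  have hrp : ¬ G.Adj r p := fun h => hpr h.symm
  obtain ⟨J, hSJ, hJP, hJ, hdom⟩ := exists_maximal_indep (G := G) (S := {p, r})
    (P := Finset.univ.filter fun u => u ∉ ({a, b, c, d, a', d'} : Set V))
    (by
      intro u hu
      simp only [Finset.mem_insert, Finset.mem_singleton] at hu
      rcases hu with rfl | rfl <;> simp only [Finset.mem_filter, Finset.mem_univ, true_and] <;>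
        assumption)
    (by
      intro u hu v hv
      simp only [Finset.mem_insert, Finset.mem_singleton] at hu hv
      rcases hu with rfl | rfl <;> rcases hv with rfl | rfl <;> simp [hpr, hrp])
  have hout : ∀ u ∈ J, u ≠ a ∧ u ≠ b ∧ u ≠ c ∧ u ≠ d ∧ u ≠ a' ∧ u ≠ d' := by
    intro u hu
    simpa using hJP hu
  have hpJ : p ∈ J := hSJ (by simp)
  have hrJ : r ∈ J := hSJ (by simp)
  have haJ : ∀ u ∈ J, ¬ G.Adj a u := fun u hu h => by
    have h1 := hout u hu
    have h2 := ha u h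
    tauto
  have hdJ : ∀ u ∈ J, ¬ G.Adj d u := fun u hu h => by
    have h1 := hout u hu
    have h2 := hd u h
    tauto
  have hcard := card_le_card_of_dominationNumber_eq hγ (D := insert b J)
    (I := insert a (insert d J)) (by
      intro v hv
      simp only [Finset.mem_insert, not_or] at hv
      by_cases hvP : v ∈ ({a, b, c, d, a', d'} : Set V)
      · simp only [Set.mem_insert_iff, Set.mem_singleton_iff] at hvP
        rcases hvP with rfl | rfl | rfl | rfl | rfl | rfl
        · exact ⟨b, by simp, hab⟩
        · exact absurd rfl hv.1
        · exact ⟨b, by simp, hbc.symm⟩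
        · exact ⟨b, by simp, hdb⟩
        · exact ⟨p, by simp [hpJ], hp⟩
        · exact ⟨r, by simp [hrJ], hr⟩
      · obtain ⟨u, hu, h⟩ := hdom v (by simpa using hvP) hv.2
        exact ⟨u, by simp [hu], h⟩) (by
      intro u hu v hv
      simp only [Finset.mem_insert] at hu hv
      rcases hu with rfl | rfl | hu <;> rcases hv with rfl | rfl | hv
      · exact G.irrefl
      · exact hda
      · exact haJ v hv
      · exact fun h => hda h.symm
      · exact G.irrefl
      · exact hdJ v hv
      · exact fun h => haJ u hu h.symm
      · exact fun h => hdJ u hu h.symm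
      · exact hJ u hu v hv)
  have hdnJ : d ∉ J := fun h => (hout d h).2.2.2.1 rfl
  have hanJ : a ∉ insert d J := by
    simp only [Finset.mem_insert, not_or]
    exact ⟨hne, fun h => (hout a h).1 rfl⟩
  rw [Finset.card_insert_of_notMem hanJ, Finset.card_insert_of_notMem hdnJ] at hcard
  have := Finset.card_insert_le b J
  omega

variable [DecidableRel G.Adj]

/-- A claw-free cubic graph whose domination and independence numbers agree has no diamond. -/
lemma dominationNumber_ne_of_diamond (hcubic : G.IsRegularOfDegree 3) (hG : ClawFree G)
    {a b c d : V} (hne : a ≠ d) (hda : ¬ G.Adj a d) (hbc : G.Adj b c) (hab : G.Adj a b)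
    (hac : G.Adj a c) (hdb : G.Adj d b) (hdc : G.Adj d c) :
    dominationNumber G ≠ G.indepNum := by
  have hb := adj_iff_of_three hcubic hac.ne hne hdc.ne.symm hab.symm hbc hdb.symm
  have hc := adj_iff_of_three hcubic hab.ne hne hdb.ne.symm hac.symm hbc.symm hdc.symm
  -- the outer neighbor of a tip, together with its own triangle
  have key : ∀ x y, x ≠ y → ¬ G.Adj x y → G.Adj x b → G.Adj x c →
      (∀ u, G.Adj b u ↔ u = x ∨ u = c ∨ u = y) → (∀ u, G.Adj c u ↔ u = x ∨ u = b ∨ u = y) →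
      ∃ x' p q, (∀ u, G.Adj x u ↔ u = b ∨ u = c ∨ u = x') ∧ x' ≠ b ∧ x' ≠ c ∧ x' ≠ x ∧ x' ≠ y ∧
        p ≠ q ∧ p ≠ x ∧ q ≠ x ∧ p ≠ b ∧ q ≠ b ∧ p ≠ c ∧ q ≠ c ∧ G.Adj p q ∧
        (∀ u, G.Adj x' u ↔ u = p ∨ u = q ∨ u = x) := by
    intro x y hxy hnxy hxb hxc hb hc
    obtain ⟨x', hx'b, hx'c, hx⟩ := adj_iff_of_two hcubic hbc.ne hxb hxc
    have hx'x : x' ≠ x := fun h => G.irrefl ((hx x).2 (by simp [h]))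
    have hx'y : x' ≠ y := fun h => hnxy ((hx y).2 (by simp [h]))
    obtain ⟨p, q, r, hpq, hpr, hqr, hadj, hx'⟩ := exists_neighbors_adj hcubic hG x'
    have hnb : ∀ u, G.Adj x' u → u ≠ b := by
      rintro u hu rfl
      have := (hb x').1 hu.symm
      tauto
    have hnc : ∀ u, G.Adj x' u → u ≠ c := by
      rintro u hu rfl
      have := (hc x').1 hu.symm
      tauto
    have hnx : ∀ u, G.Adj x' u → ¬ G.Adj x u := by
      intro u hu h
      have h1 := (hx u).1 h
      have h2 := hnb u hu
      have h3 := hnc u hu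
      have h4 := hu.ne
      grind
    have hp := (hx' p).2 (by simp)
    have hq := (hx' q).2 (by simp)
    have hpx : p ≠ x := fun h => hnx q hq (h ▸ hadj)
    have hqx : q ≠ x := fun h => hnx p hp (h ▸ hadj.symm)
    have hrx : x = r := by
      have := (hx' x).1 ((hx x').2 (by simp)).symm
      grind
    subst hrx
    exact ⟨x', p, q, hx, hx'b, hx'c, hx'x, hx'y, hpq, hpr, hqr, hnb p hp, hnb q hq, hnc p hp,
      hnc q hq, hadj, hx'⟩
  obtain ⟨a', p, q, ha, ha'b, ha'c, ha'a, ha'd, hpq, hpa, hqa, hpb, hqb, hpc, hqc, hadj, ha'⟩ :=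
    key a d hne hda hab hac hb hc
  obtain ⟨d', r, s, hd, hd'b, hd'c, hd'd, hd'a, hrs, hrd, hsd, hrb, hsb, hrc, hsc, hadj', hd'⟩ :=
    key d a hne.symm (fun h => hda h.symm) hdb hdc (fun u => by rw [hb]; tauto)
      (fun u => by rw [hc]; tauto)
  -- If the outer neighbors coincided, `d` would be `p` or `q`, and the other of these would be a
  -- neighbor of `d` other than `b`, `c`, `d'`.
  have had' : a' ≠ d' := by
    rintro rfl
    have h1 : G.Adj a' d := ((hd a').2 (by simp)).symm
    rcases (ha' d).1 h1 with h | h | h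
    · have h2 := (hd q).1 (h ▸ hadj)
      have h3 := (ha' q).2 (by simp)
      rcases h2 with h2 | h2 | h2
      · exact hqb h2
      · exact hqc h2
      · exact h3.ne h2.symm
    · have h2 := (hd p).1 (h ▸ hadj.symm)
      have h3 := (ha' p).2 (by simp)
      rcases h2 with h2 | h2 | h2
      · exact hpb h2
      · exact hpc h2
      · exact h3.ne h2.symm
    · exact hne h.symm
  have hex : ∃ x y, G.Adj a' x ∧ x ≠ a ∧ G.Adj d' y ∧ y ≠ d ∧ ¬ G.Adj x y ∧ x ≠ d' ∧ y ≠ a' := by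
    have hp := (ha' p).2 (by simp)
    have hq := (ha' q).2 (by simp)
    have hr := (hd' r).2 (by simp)
    have hs := (hd' s).2 (by simp)
    have hda'' : d ≠ a' := ha'd.symm
    by_cases had : G.Adj a' d'
    -- Here `d'` is `p` or `q`, and the other one is adjacent to both `a'` and `d'`, so it serves as
    -- both `x` and `y`.
    · rcases (ha' d').1 had with h | h | h
      · have h2 : G.Adj d' q := h ▸ hadj
        refine ⟨q, q, hq, hqa, h2, ?_, G.irrefl, h2.ne.symm, hq.ne.symm⟩
        rintro rfl
        rcases (hd a').1 hq.symm with h | h | h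
        exacts [ha'b h, ha'c h, had' h]
      · have h2 : G.Adj d' p := h ▸ hadj.symm
        refine ⟨p, p, hp, hpa, h2, ?_, G.irrefl, h2.ne.symm, hp.ne.symm⟩
        rintro rfl
        rcases (hd a').1 hp.symm with h | h | h
        exacts [ha'b h, ha'c h, had' h]
      · exact absurd h hd'a
    · have hpd' : p ≠ d' := fun h => had (h ▸ hp)
      have hqd' : q ≠ d' := fun h => had (h ▸ hq)
      have hra' : r ≠ a' := fun h => had (h ▸ hr).symm
      have hsa' : s ≠ a' := fun h => had (h ▸ hs).symm
      by_cases hpr : G.Adj p r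
      · by_cases hps : G.Adj p s
        -- The neighbors of `p` are now `a'`, `r`, `s`, so `q` is `r` or `s` and again serves twice.
        · have hp3 := (adj_iff_of_three hcubic hra'.symm hsa'.symm hrs hp.symm hpr hps q).1 hadj
          have hqd : G.Adj d' q := (hd' q).2 (by have := hq.ne; tauto)
          refine ⟨q, q, hq, hqa, hqd, ?_, G.irrefl, hqd', hq.ne.symm⟩
          have := hq.ne
          grind
        · exact ⟨p, s, hp, hpa, hs, hsd, hps, hpd', hsa'⟩
      · exact ⟨p, r, hp, hpa, hr, hrd, hpr, hpd', hra'⟩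
  obtain ⟨x, y, hx, hxa, hy, hyd, hxy, hxd', hya'⟩ := hex
  refine dominationNumber_ne_of_exchange hne hda hab hdb hbc (fun u => (ha u).1)
    (fun u => (hd u).1) hx hy hxy ?_ ?_
  · simp only [Set.mem_insert_iff, Set.mem_singleton_iff, not_or]
    refine ⟨hxa, ?_, ?_, ?_, hx.ne.symm, hxd'⟩
    · rintro rfl
      rcases (hb a').1 hx.symm with h | h | h
      exacts [ha'a h, ha'c h, ha'd h]
    · rintro rfl
      rcases (hc a').1 hx.symm with h | h | h
      exacts [ha'a h, ha'b h, ha'd h]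
    · rintro rfl
      rcases (hd a').1 hx.symm with h | h | h
      exacts [ha'b h, ha'c h, had' h]
  · simp only [Set.mem_insert_iff, Set.mem_singleton_iff, not_or]
    refine ⟨?_, ?_, ?_, hyd, hya', hy.ne.symm⟩
    · rintro rfl
      rcases (ha d').1 hy.symm with h | h | h
      exacts [hd'b h, hd'c h, had' h.symm]
    · rintro rfl
      rcases (hb d').1 hy.symm with h | h | h
      exacts [hd'a h, hd'c h, hd'd h]
    · rintro rfl
      rcases (hc d').1 hy.symm with h | h | h
      exacts [hd'a h, hd'b h, hd'd h]

end Diamond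

/-! ### Partition into triangles -/

section Triangles

variable {V : Type*} {G : SimpleGraph V}

/-- A partition of the vertices of a graph into triangles, given by the triangle `tri v` of each
vertex `v`, such that the edges between triangles form a perfect matching `v ↦ σ v`. -/
structure TrianglePartition (G : SimpleGraph V) (tri : V → Finset V) (σ : V → V) : Prop where
  mem_iff : ∀ u v, u ∈ tri v ↔ tri u = tri v
  card_tri : ∀ v, (tri v).card = 3
  invol : ∀ v, σ (σ v) = v
  tri_ne : ∀ v, tri (σ v) ≠ tri v
  adj_iff : ∀ u v, G.Adj u v ↔ (u ≠ v ∧ tri u = tri v) ∨ v = σ u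

/-- An edge in two triangles would give K₄ or a diamond. So each vertex lies in exactly one
triangle, and its third edge lies in none; `σ` follows that edge. -/
lemma exists_trianglePartition [Fintype V] [DecidableRel G.Adj] (hconn : G.Connected)
    (hcubic : G.IsRegularOfDegree 3) (hG : ClawFree G) (hγ : dominationNumber G = G.indepNum)
    (hK : ¬ Nonempty (G ≃g SimpleGraph.completeGraph (Fin 4))) :
    ∃ (tri : V → Finset V) (σ : V → V), TrianglePartition G tri σ := by
  classical
  -- no edge lies in two triangles
  have hedge : ∀ v a b c, a ≠ b → G.Adj v a → G.Adj v b → G.Adj v c → G.Adj c a → G.Adj c b →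
      False := by
    intro v a b c hab hva hvb hvc hca hcb
    by_cases h : G.Adj a b
    · exact hK (iso_complete_of_adj hconn hcubic hva hvb hvc h hca.symm hcb.symm)
    · exact dominationNumber_ne_of_diamond hcubic hG hab h hvc hva.symm hca.symm hvb.symm hcb.symm hγ
  have hloc := exists_neighbors_adj hcubic hG
  choose p q σ hpq hpσ hqσ hadj hv using hloc
  have hp : ∀ v, G.Adj v (p v) := fun v => (hv v _).2 (by simp)
  have hq : ∀ v, G.Adj v (q v) := fun v => (hv v _).2 (by simp)
  have hσ : ∀ v, G.Adj v (σ v) := fun v => (hv v _).2 (by simp)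
  have hσp : ∀ v, ¬ G.Adj (σ v) (p v) := fun v h =>
    hedge v (σ v) (q v) (p v) (hqσ v).symm (hσ v) (hq v) (hp v) h.symm (hadj v)
  have hσq : ∀ v, ¬ G.Adj (σ v) (q v) := fun v h =>
    hedge v (σ v) (p v) (q v) (hpσ v).symm (hσ v) (hp v) (hq v) h.symm (hadj v).symm
  -- neighbors of `v` are adjacent only if they are `p v` and `q v`
  have hcomm : ∀ v x, G.Adj v x → ¬ G.Adj (σ v) x := by
    intro v x hx h
    rcases (hv v x).1 hx with rfl | rfl | rfl
    exacts [hσp v h, hσq v h, G.irrefl h]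
  have hpqeq : ∀ v x y, G.Adj v x → G.Adj v y → G.Adj x y →
      ({v, p v, q v} : Finset V) = {v, x, y} := by
    intro v x y hx hy hxy
    have hxσ : x ≠ σ v := fun h => hcomm v y hy (h ▸ hxy)
    have hyσ : y ≠ σ v := fun h => hcomm v x hx (h ▸ hxy.symm)
    have h1 := (hv v x).1 hx
    have h2 := (hv v y).1 hy
    have h3 := hxy.ne
    ext u
    simp only [Finset.mem_insert, Finset.mem_singleton]
    grind
  -- If `v` were in the triangle of `σ v`, the third vertex of that triangle would be a common
  -- neighbor of `v` and `σ v`.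
  have hinv : ∀ v, σ (σ v) = v := by
    intro v
    rcases (hv (σ v) v).1 (hσ v).symm with h | h | h
    · have h1 := hadj (σ v)
      rw [← h] at h1
      exact absurd (hq (σ v)) (hcomm v _ h1)
    · have h1 := (hadj (σ v)).symm
      rw [← h] at h1
      exact absurd (hp (σ v)) (hcomm v _ h1)
    · exact h.symm
  have htri : ∀ u v, u ∈ ({v, p v, q v} : Finset V) →
      ({u, p u, q u} : Finset V) = {v, p v, q v} := by
    intro u v hu
    simp only [Finset.mem_insert, Finset.mem_singleton] at hu
    rcases hu with rfl | rfl | rfl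
    · rfl
    · rw [hpqeq (p v) v (q v) (hp v).symm (hadj v) (hq v), Finset.insert_comm]
    · rw [hpqeq (q v) v (p v) (hq v).symm (hadj v).symm (hp v), Finset.insert_comm,
        Finset.pair_comm]
  have hmem : ∀ u v, u ∈ ({v, p v, q v} : Finset V) ↔
      ({u, p u, q u} : Finset V) = {v, p v, q v} :=
    fun u v => ⟨htri u v, fun h => h ▸ Finset.mem_insert_self u _⟩
  refine ⟨fun v => {v, p v, q v}, σ, hmem, fun v => ?_, hinv, fun v h => ?_, fun u v => ?_⟩
  · exact Finset.card_eq_three.2 ⟨_, _, _, (hp v).ne, (hq v).ne, hpq v, rfl⟩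
  · have := (hmem _ _).2 h
    simp only [Finset.mem_insert, Finset.mem_singleton] at this
    rcases this with h | h | h
    exacts [(hσ v).ne h.symm, hpσ v h.symm, hqσ v h.symm]
  · rw [hv u v, ← or_assoc]
    refine or_congr ?_ Iff.rfl
    rw [eq_comm (a := ({u, p u, q u} : Finset V)), ← hmem]
    simp only [Finset.mem_insert, Finset.mem_singleton]
    have h1 := (hp u).ne
    have h2 := (hq u).ne
    grind

end Triangles

/-! ### Cycles from two involutions -/

section Cycle

/-- Two fixed-point-free involutions trace out an even cycle through every point. -/
lemma exists_alternating_cycle {Z : Type*} [Finite Z] {σ τ : Z → Z} (hσ : Function.Involutive σ)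
    (hτ : Function.Involutive τ) (hσ' : ∀ z, σ z ≠ z) (hτ' : ∀ z, τ z ≠ z) (z₀ : Z) :
    ∃ k : ℕ, 1 ≤ k ∧ ∃ g : ZMod k × Bool → Z, Function.Injective g ∧
      (∀ i, g (i, true) = τ (g (i, false))) ∧ ∀ i, g (i + 1, false) = σ (g (i, true)) := by
  set ρ : Z → Z := σ ∘ τ with hρ
  have hinj : Function.Injective ρ := hσ.injective.comp hτ.injective
  -- An equality for `m + 2` at `z` cancels to one for `m` at `ρ z`, ending in a fixed point of `τ`
  -- or of `σ`.
  have hbase : ∀ m z, ρ^[m] z ≠ τ z := by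
    intro m
    induction m using Nat.twoStepInduction with
    | zero => exact fun z h => hτ' z h.symm
    | one => exact fun z h => hσ' (τ z) h
    | more m ih _ =>
      intro z h
      have h1 : ρ^[m + 2] z = σ (τ (ρ^[m] (ρ z))) := by
        rw [← Function.iterate_succ_apply, Function.iterate_succ_apply' ρ (m + 1)]
        rfl
      have h2 : τ z = σ (ρ z) := (hσ (τ z)).symm
      rw [h1, h2] at h
      have h3 := hσ.injective h
      exact ih (ρ z) (by rw [← hτ (ρ^[m] (ρ z)), h3])
  have hne : ∀ n m z, ρ^[m] z ≠ τ (ρ^[n] z) := by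
    intro n
    induction n with
    | zero => exact hbase
    | succ n ih =>
      intro m z h
      refine ih (m + 1) z ?_
      rw [Function.iterate_succ_apply', h, Function.iterate_succ_apply']
      simp only [hρ, Function.comp_apply, hτ _, hσ _]
  have hper : z₀ ∈ Function.periodicPts ρ := hinj.mem_periodicPts z₀
  have hpos := Function.minimalPeriod_pos_of_mem_periodicPts hper
  set k := Function.minimalPeriod ρ z₀ with hk
  have : NeZero k := ⟨hpos.ne'⟩
  have hval : ∀ i j : ZMod k, ρ^[i.val] z₀ = ρ^[j.val] z₀ → i = j := fun i j h =>
    ZMod.val_injective k <|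
      (Function.iterate_eq_iterate_iff_of_lt_minimalPeriod (ZMod.val_lt i) (ZMod.val_lt j)).1 h
  refine ⟨k, hpos, fun p => bif p.2 then τ (ρ^[p.1.val] z₀) else ρ^[p.1.val] z₀, ?_, ?_, ?_⟩
  · rintro ⟨i, _ | _⟩ ⟨j, _ | _⟩ h
    · rw [hval i j h]
    · exact absurd h (hne _ _ _)
    · exact absurd h.symm (hne _ _ _)
    · rw [hval i j (hτ.injective h)]
  · exact fun i => rfl
  · intro i
    change ρ^[(i + 1).val] z₀ = ρ (ρ^[i.val] z₀)
    rw [ZMod.val_add, ZMod.val_one_eq_one_mod, Nat.add_mod_mod,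
      Function.iterate_mod_minimalPeriod_eq, Function.iterate_succ_apply']

end Cycle

/-! ### Recognizing a necklace -/

section Necklace

variable {V : Type*} [Fintype V] {G : SimpleGraph V} [DecidableRel G.Adj]

/-- An injective homomorphism from a triangle-necklace to a connected cubic graph is an
isomorphism. -/
lemma iso_triangleNecklace_of_injective (hconn : G.Connected) (hcubic : G.IsRegularOfDegree 3)
    {k : ℕ} {f : ZMod k × Bool × Fin 3 → V} (hf : Function.Injective f)
    (hadj : ∀ u v, NecklaceRel k u v → G.Adj (f u) (f v)) :
    Nonempty (G ≃g triangleNecklace k) := by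
  have hhom : ∀ u v, (triangleNecklace k).Adj u v → G.Adj (f u) (f v) := by
    intro u v h
    rw [triangleNecklace, SimpleGraph.fromRel_adj] at h
    exact h.2.elim (hadj u v) fun h => (hadj v u h).symm
  have hout : ∀ (i : ZMod k) (b : Bool) (c : Fin 3), ∃ (j : ZMod k) (b' : Bool) (d : Fin 3),
      b' ≠ b ∧ (triangleNecklace k).Adj (i, b, c) (j, b', d) := by
    intro i b c
    simp only [triangleNecklace, SimpleGraph.fromRel_adj]
    cases b <;> fin_cases c
    · exact ⟨i, true, 0, by simp, by simp, .inl (.edge_a i)⟩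
    · exact ⟨i, true, 1, by simp, by simp, .inl (.edge_b i)⟩
    · refine ⟨i - 1, true, 2, by simp, by simp, .inr ?_⟩
      have := NecklaceRel.edge_c (i - 1)
      rwa [sub_add_cancel] at this
    · exact ⟨i, false, 0, by simp, by simp, .inr (.edge_a i)⟩
    · exact ⟨i, false, 1, by simp, by simp, .inr (.edge_b i)⟩
    · exact ⟨i + 1, false, 2, by simp, by simp, .inl (.edge_c i)⟩
  -- The images of three distinct neighbors of `u` are all the neighbors of `f u`, since G is cubic.
  -- This yields both surjectivity and reflection of adjacency.
  have hlift : ∀ u w, G.Adj (f u) w → ∃ v, f v = w ∧ (triangleNecklace k).Adj u v := by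
    rintro ⟨i, b, c⟩ w hw
    obtain ⟨j, b', d, hb, hj⟩ := hout i b c
    have h1 : (triangleNecklace k).Adj (i, b, c) (i, b, c + 1) :=
      triangleNecklace_adj_same (by simp)
    have h2 : (triangleNecklace k).Adj (i, b, c) (i, b, c + 2) :=
      triangleNecklace_adj_same (by simp)
    have h := (adj_iff_of_three hcubic (hf.ne ?_) (hf.ne ?_) (hf.ne ?_) (hhom _ _ h1)
      (hhom _ _ h2) (hhom _ _ hj) w).1 hw
    · rcases h with rfl | rfl | rfl
      exacts [⟨_, rfl, h1⟩, ⟨_, rfl, h2⟩, ⟨_, rfl, hj⟩]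
    · simp
    · simp [hb.symm]
    · simp [hb.symm]
  have hsurj : Function.Surjective f := by
    refine mem_of_connected hconn (S := Set.range f) (v := f (0, false, 0)) ⟨_, rfl⟩ ?_
    rintro _ ⟨u, rfl⟩ w hw
    obtain ⟨v, hv, -⟩ := hlift u w hw
    exact ⟨v, hv⟩
  refine ⟨(⟨Equiv.ofBijective f ⟨hf, hsurj⟩, ?_⟩ : triangleNecklace k ≃g G).symm⟩
  intro u v
  refine ⟨fun h => ?_, hhom u v⟩
  obtain ⟨v', hv', h'⟩ := hlift u (f v) h
  rwa [← hf hv']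

end Necklace

/-! ### From a triangle partition to a necklace -/

namespace TrianglePartition

variable {V : Type*} {G : SimpleGraph V} {tri : V → Finset V} {σ : V → V}

lemma adj_of_tri_eq (h : TrianglePartition G tri σ) {u v : V} (hne : u ≠ v)
    (huv : tri u = tri v) : G.Adj u v :=
  (h.adj_iff u v).2 (.inl ⟨hne, huv⟩)

lemma adj_outer (h : TrianglePartition G tri σ) (v : V) : G.Adj v (σ v) :=
  (h.adj_iff v (σ v)).2 (.inr rfl)

lemma outer_injective (h : TrianglePartition G tri σ) : Function.Injective σ :=
  Function.Involutive.injective h.invol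

lemma self_mem (h : TrianglePartition G tri σ) (v : V) : v ∈ tri v := (h.mem_iff v v).2 rfl

lemma eq_of_tri_eq (h : TrianglePartition G tri σ) {x y z u : V} (hxy : x ≠ y) (hxz : x ≠ z)
    (hyz : y ≠ z) (hx : tri x = tri u) (hy : tri y = tri u) (hz : tri z = tri u) :
    u = x ∨ u = y ∨ u = z := by
  classical
  have hsub : ({x, y, z} : Finset V) ⊆ tri u := by
    intro w hw
    rw [h.mem_iff]
    simp only [Finset.mem_insert, Finset.mem_singleton] at hw
    rcases hw with rfl | rfl | rfl <;> assumption
  have heq := Finset.eq_of_subset_of_card_le hsub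
    (by rw [h.card_tri, Finset.card_eq_three.2 ⟨x, y, z, hxy, hxz, hyz, rfl⟩])
  have := h.self_mem u
  rw [← heq] at this
  simpa using this

lemma exists_third (h : TrianglePartition G tri σ) {x y : V} (hxy : x ≠ y) :
    ∃ z, z ≠ x ∧ z ≠ y ∧ tri z = tri x := by
  classical
  have : ({x, y} : Finset V).card < (tri x).card := by
    rw [h.card_tri, Finset.card_pair hxy]
    norm_num
  obtain ⟨z, hz, hz'⟩ := Finset.exists_mem_notMem_of_card_lt_card this
  simp only [Finset.mem_insert, Finset.mem_singleton, not_or] at hz'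
  exact ⟨z, hz'.1, hz'.2, (h.mem_iff z x).1 hz⟩

variable [Fintype V]

open Classical in
/-- By Hall's theorem there is an independent set meeting every triangle. -/
lemma exists_indep (h : TrianglePartition G tri σ) :
    ∃ I : Finset V, (∀ u ∈ I, ∀ v ∈ I, ¬ G.Adj u v) ∧ I.card = (Finset.univ.image tri).card := by
  -- Hall's theorem matches triangles to distinct matching edges: n triangles have 3n vertices, and
  -- each edge covers at most two. Chosen vertices in different triangles could be adjacent only
  -- along a common matching edge.
  set m : V → Sym2 V := fun v => s(v, σ v) with hm
  have hmem : ∀ (T : {T // T ∈ Finset.univ.image tri}) (v : V), v ∈ T.1 → tri v = T.1 := by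
    rintro ⟨T, hT⟩ v hv
    obtain ⟨w, -, rfl⟩ := Finset.mem_image.1 hT
    exact (h.mem_iff v w).1 hv
  have hcardT : ∀ T : {T // T ∈ Finset.univ.image tri}, T.1.card = 3 := by
    rintro ⟨T, hT⟩
    obtain ⟨w, -, rfl⟩ := Finset.mem_image.1 hT
    exact h.card_tri w
  obtain ⟨f, hf, hfm⟩ := (Finset.all_card_le_biUnion_card_iff_exists_injective
    (fun T : {T // T ∈ Finset.univ.image tri} => T.1.image m)).1 (by
      intro s
      have h1 : (s.biUnion fun T => T.1).card = 3 * s.card := by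
        rw [Finset.card_biUnion, Finset.sum_congr rfl fun T _ => hcardT T]
        · simp [mul_comm]
        · intro T _ T' _ hne
          refine Finset.disjoint_left.2 fun v hv hv' => hne ?_
          exact Subtype.ext ((hmem T v hv).symm.trans (hmem T' v hv'))
      have h2 : (s.biUnion fun T => T.1.image m) = (s.biUnion fun T => T.1).image m :=
        (Finset.biUnion_image ..).symm
      have h3 := Finset.card_le_mul_card_image (f := m) (s.biUnion fun T => T.1) 2 (by
        intro a ha
        obtain ⟨v, -, rfl⟩ := Finset.mem_image.1 ha
        refine (Finset.card_le_card (t := {v, σ v}) fun x hx => ?_).trans Finset.card_le_two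
        have := (Finset.mem_filter.1 hx).2
        simp only [hm, Sym2.eq_iff] at this
        rcases this with h | h <;> simp [h.1])
      rw [h2]
      omega)
  have hg : ∀ T, ∃ v ∈ T.1, m v = f T := fun T => Finset.mem_image.1 (hfm T)
  choose g hgT hgf using hg
  have hginj : Function.Injective g := fun T T' hTT' => hf (by rw [← hgf, ← hgf, hTT'])
  refine ⟨Finset.univ.image g, ?_, ?_⟩
  · intro u hu v hv huv
    obtain ⟨T, -, rfl⟩ := Finset.mem_image.1 hu
    obtain ⟨T', -, rfl⟩ := Finset.mem_image.1 hv
    have hTT' : T = T' := by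
      rcases (h.adj_iff _ _).1 huv with ⟨-, h1⟩ | h1
      · rw [hmem T _ (hgT T), hmem T' _ (hgT T')] at h1
        exact Subtype.ext h1
      · refine hf ?_
        rw [← hgf T, ← hgf T', hm]
        simp only [h1, h.invol]
        exact Sym2.eq_swap
    rw [hTT'] at huv
    exact G.irrefl huv
  · rw [Finset.card_image_of_injective _ hginj, Finset.card_univ, Fintype.card_coe]

/-- In the extremal case every triangle is joined to some other triangle by two edges. -/
lemma exists_double (h : TrianglePartition G tri σ) (hγ : dominationNumber G = G.indepNum)
    (v : V) : ∃ x y, x ≠ y ∧ tri x = tri v ∧ tri y = tri v ∧ tri (σ x) = tri (σ y) := by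
  classical
  by_contra! hcon
  have hinj : ∀ x ∈ tri v, ∀ y ∈ tri v, tri (σ x) = tri (σ y) → x = y := by
    intro x hx y hy hxy
    by_contra hne
    exact hcon x y hne ((h.mem_iff _ _).1 hx) ((h.mem_iff _ _).1 hy) hxy
  obtain ⟨J, hSJ, hJP, hJ, hdom⟩ := exists_maximal_indep (G := G) (S := (tri v).image σ)
    (P := Finset.univ.filter fun u => u ∉ tri v)
    (by
      intro u hu
      obtain ⟨x, hx, rfl⟩ := Finset.mem_image.1 hu
      simp only [Finset.mem_filter, Finset.mem_univ, true_and]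
      rw [h.mem_iff] at hx ⊢
      exact fun h' => h.tri_ne x (h'.trans hx.symm))
    (by
      intro u hu w hw huw
      obtain ⟨x, hx, rfl⟩ := Finset.mem_image.1 hu
      obtain ⟨y, hy, rfl⟩ := Finset.mem_image.1 hw
      rcases (h.adj_iff _ _).1 huw with ⟨h1, h2⟩ | h1
      · exact h1 (by rw [hinj x hx y hy h2])
      · rw [h.invol] at h1
        rw [h.mem_iff] at hx hy
        exact h.tri_ne y (by rw [h1, hx, hy]))
  obtain ⟨I, hI, hIcard⟩ := h.exists_indep
  have h1 := card_le_card_of_dominationNumber_eq hγ (D := J) (I := I) (by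
    intro u hu
    by_cases huv : u ∈ tri v
    · exact ⟨σ u, hSJ (Finset.mem_image_of_mem σ huv), h.adj_outer u⟩
    · exact hdom u (by simpa using huv) hu) hI
  -- `J` has at most one vertex in each triangle and none in `tri v`.
  have h2 : J.card ≤ ((Finset.univ.image tri).erase (tri v)).card := by
    refine Finset.card_le_card_of_injOn tri ?_ ?_
    · intro u hu
      have := hJP hu
      simp only [Finset.mem_filter, Finset.mem_univ, true_and, h.mem_iff] at this
      simp [this]
    · intro a ha b hb hab
      by_contra hne
      exact hJ a ha b hb (h.adj_of_tri_eq hne hab)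
  have hmem : tri v ∈ Finset.univ.image tri := Finset.mem_image_of_mem _ (Finset.mem_univ v)
  have h3 := Finset.card_erase_lt_of_mem hmem
  omega

variable [DecidableRel G.Adj]

lemma iso_triangleNecklace (h : TrianglePartition G tri σ) (hconn : G.Connected)
    (hcubic : G.IsRegularOfDegree 3) {k : ℕ} {f : ZMod k × Bool × Fin 3 → V}
    (hf : Function.Injective f) (htri : ∀ i b c d, tri (f (i, b, c)) = tri (f (i, b, d)))
    (ha : ∀ i, f (i, true, 0) = σ (f (i, false, 0)))
    (hb : ∀ i, f (i, true, 1) = σ (f (i, false, 1)))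
    (hc : ∀ i, f (i + 1, false, 2) = σ (f (i, true, 2))) :
    Nonempty (G ≃g triangleNecklace k) := by
  refine iso_triangleNecklace_of_injective hconn hcubic hf fun u v huv => ?_
  cases huv with
  | triangle i b c d hcd =>
    exact h.adj_of_tri_eq (fun h' => hcd (by simpa using hf h')) (htri i b c d)
  | edge_a i => rw [ha]; exact h.adj_outer _
  | edge_b i => rw [hb]; exact h.adj_outer _
  | edge_c i => rw [hc]; exact h.adj_outer _

/-- Two triangles joined by three edges form the prism `F₂`. -/
lemma iso_prism (h : TrianglePartition G tri σ) (hconn : G.Connected)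
    (hcubic : G.IsRegularOfDegree 3) {x y z : V} (hxy : x ≠ y) (hxz : x ≠ z) (hyz : y ≠ z)
    (hy : tri y = tri x) (hz : tri z = tri x) (hσy : tri (σ y) = tri (σ x))
    (hσz : tri (σ z) = tri (σ x)) : Nonempty (G ≃g triangleNecklace 1) := by
  have hvec : ∀ c, tri (![x, y, z] c) = tri x := by
    intro c
    fin_cases c <;> simp [hy, hz]
  have hvecσ : ∀ c, tri (σ (![x, y, z] c)) = tri (σ x) := by
    intro c
    fin_cases c <;> simp [hσy, hσz]
  have hinj : Function.Injective ![x, y, z] := by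
    intro c d
    fin_cases c <;> fin_cases d <;> simp [hxy, hxz, hyz, hxy.symm, hxz.symm, hyz.symm]
  -- For k = 1 the indices `i` and `i + 1` coincide, so the third matching edge closes the necklace.
  refine h.iso_triangleNecklace hconn hcubic (k := 1)
    (f := fun p => bif p.2.1 then σ (![x, y, z] p.2.2) else ![x, y, z] p.2.2) ?_ ?_
    (fun i => rfl) (fun i => rfl) (fun i => (h.invol _).symm)
  · rintro ⟨i, b, c⟩ ⟨j, b', d⟩ hcd
    obtain rfl : i = j := Subsingleton.elim _ _
    cases b <;> cases b' <;> simp only [cond_true, cond_false] at hcd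
    · rw [hinj hcd]
    · refine absurd ?_ (h.tri_ne x)
      rw [← hvecσ d, ← hcd, hvec]
    · refine absurd ?_ (h.tri_ne x)
      rw [← hvecσ c, hcd, hvec]
    · rw [hinj (h.outer_injective hcd)]
  · rintro i (_ | _) c d
    · exact (hvec c).trans (hvec d).symm
    · exact (hvecσ c).trans (hvecσ d).symm

/-- If every triangle is joined to another one by two but not three edges, then the graph is a
triangle-necklace. -/
lemma exists_iso_of_double (h : TrianglePartition G tri σ) (hconn : G.Connected)
    (hcubic : G.IsRegularOfDegree 3)
    (hdouble : ∀ v, ∃ x y, x ≠ y ∧ tri x = tri v ∧ tri y = tri v ∧ tri (σ x) = tri (σ y))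
    (hprism : ∀ x y z, x ≠ y → x ≠ z → y ≠ z → tri y = tri x → tri z = tri x →
      tri (σ y) = tri (σ x) → tri (σ z) ≠ tri (σ x)) :
    ∃ k : ℕ, 1 ≤ k ∧ Nonempty (G ≃g triangleNecklace k) := by
  classical
  -- `Z` collects the vertices whose outer edge is the only one from their triangle to its target;
  -- each triangle has exactly one, and `σ` preserves `Z`.
  set Z : Set V := {v | ∀ u, tri u = tri v → tri (σ u) = tri (σ v) → u = v} with hZ
  have hσZ : ∀ v ∈ Z, σ v ∈ Z := by
    intro v hv u hu hσu
    rw [h.invol] at hσu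
    rw [← hv (σ u) hσu (by rwa [h.invol]), h.invol]
  -- each triangle consists of one vertex of `Z` and a pair `x`, `y`
  have hshape : ∀ v, ∃ x y z, z ∈ Z ∧ x ≠ y ∧ x ≠ z ∧ y ≠ z ∧ tri x = tri v ∧ tri y = tri v ∧
      tri z = tri v ∧ tri (σ x) = tri (σ y) := by
    intro v
    obtain ⟨x, y, hxy, hx, hy, hσ⟩ := hdouble v
    obtain ⟨z, hzx, hzy, hz⟩ := h.exists_third hxy
    refine ⟨x, y, z, ?_, hxy, hzx.symm, hzy.symm, hx, hy, hz.trans hx, hσ⟩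
    intro u hu hσu
    have hne := hprism x y z hxy hzx.symm hzy.symm (hy.trans hx.symm) hz hσ.symm
    rcases h.eq_of_tri_eq hxy hzx.symm hzy.symm (hz.symm.trans hu.symm)
      ((hy.trans hx.symm).trans (hz.symm.trans hu.symm)) hu.symm with rfl | rfl | rfl
    · exact absurd hσu.symm hne
    · exact absurd (hσu.symm.trans hσ.symm) hne
    · rfl
  have huniq : ∀ a ∈ Z, ∀ b ∈ Z, tri a = tri b → a = b := by
    intro a ha b hb hab
    obtain ⟨x, y, z, -, hxy, hxz, hyz, hx, hy, hz, hσ⟩ := hshape b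
    have hxZ : x ∉ Z := fun hxZ => hxy (hxZ y (hy.trans hx.symm) hσ.symm).symm
    have hyZ : y ∉ Z := fun hyZ => hxy (hyZ x (hx.trans hy.symm) hσ)
    have hb' : b = z := by
      rcases h.eq_of_tri_eq hxy hxz hyz hx hy hz with rfl | rfl | rfl
      exacts [absurd hb hxZ, absurd hb hyZ, rfl]
    have ha' : a = z := by
      rcases h.eq_of_tri_eq hxy hxz hyz (hx.trans hab.symm) (hy.trans hab.symm)
        (hz.trans hab.symm) with rfl | rfl | rfl
      exacts [absurd ha hxZ, absurd ha hyZ, rfl]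
    rw [ha', hb']
  have hpair : ∀ z : Z, ∃ (x y : V) (w : Z), x ≠ y ∧ x ≠ z ∧ y ≠ z ∧ tri x = tri z ∧
      tri y = tri z ∧ tri (σ x) = tri w ∧ tri (σ y) = tri w ∧ σ x ≠ w ∧ σ y ≠ w := by
    rintro ⟨v, hv⟩
    obtain ⟨x, y, z, hz, hxy, hxz, hyz, hx, hy, hzv, hσ⟩ := hshape v
    obtain rfl := huniq z hz v hv hzv
    obtain ⟨-, -, w, hw, -, -, -, -, -, hwt, -⟩ := hshape (σ x)
    refine ⟨x, y, ⟨w, hw⟩, hxy, hxz, hyz, hx, hy, hwt.symm, (hwt.trans hσ).symm, ?_, ?_⟩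
    · rintro rfl
      refine hxy (h.outer_injective ?_).symm
      exact hw (σ y) hσ.symm (by rw [h.invol, h.invol, hx, hy])
    · rintro rfl
      refine hxy (h.outer_injective ?_)
      exact hw (σ x) hσ (by rw [h.invol, h.invol, hx, hy])
  choose X Y τ hXY hXz hYz hX hY hσX hσY hXw hYw using hpair
  -- `X (τ z)` is not the `Z`-vertex of its triangle, so it is `σ (X z)` or `σ (Y z)`, and its outer
  -- edge leads back to the triangle of `z`.
  have hτ : Function.Involutive τ := by
    intro z
    refine Subtype.ext (huniq _ (τ (τ z)).2 _ z.2 ?_)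
    rw [← hσX (τ z)]
    rcases h.eq_of_tri_eq (h.outer_injective.ne (hXY z)) (hXw z) (hYw z)
      ((hσX z).trans (hX (τ z)).symm) ((hσY z).trans (hX (τ z)).symm) (hX (τ z)).symm
      with h1 | h1 | h1
    · rw [h1, h.invol, hX]
    · rw [h1, h.invol, hY]
    · exact absurd h1 (hXz (τ z))
  have hτt : ∀ z, tri (τ z : V) ≠ tri z := by
    intro z h'
    exact h.tri_ne (X z) (by rw [hσX, h', hX])
  obtain ⟨v₀⟩ := hconn.nonempty
  obtain ⟨-, -, z₀, hz₀, -⟩ := hshape v₀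
  obtain ⟨k, hk, g, hg, hgτ, hgσ⟩ := exists_alternating_cycle (Z := Z)
    (σ := fun z => ⟨σ z, hσZ z z.2⟩) (fun z => Subtype.ext (h.invol z)) hτ
    (fun z h' => h.tri_ne z (congrArg (fun u : Z => tri u) h'))
    (fun z h' => hτt z (congrArg (fun u : Z => tri u) h')) ⟨z₀, hz₀⟩
  -- The second triangle of a pair is labelled through `σ`, because the choices `X (τ z)`, `Y (τ z)`
  -- might come in the opposite order.
  set f : ZMod k × Bool × Fin 3 → V := fun p =>
    bif p.2.1 then ![σ (X (g (p.1, false))), σ (Y (g (p.1, false))), g (p.1, true)] p.2.2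
    else ![X (g (p.1, false)), Y (g (p.1, false)), g (p.1, false)] p.2.2 with hf
  have htri : ∀ i b c, tri (f (i, b, c)) = tri (g (i, b)) := by
    rintro i (_ | _) c <;> fin_cases c <;> simp [hf, hX, hY, hσX, hσY, hgτ]
  have hinj : ∀ i b, Function.Injective fun c => f (i, b, c) := by
    have hvec : ∀ x y z : V, x ≠ y → x ≠ z → y ≠ z → Function.Injective ![x, y, z] := by
      intro x y z hxy hxz hyz c d
      fin_cases c <;> fin_cases d <;> simp [hxy, hxz, hyz, hxy.symm, hxz.symm, hyz.symm]
    rintro i (_ | _)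
    · exact hvec (X (g (i, false))) (Y (g (i, false))) (g (i, false)) (hXY _) (hXz _) (hYz _)
    · refine hvec (σ (X (g (i, false)))) (σ (Y (g (i, false)))) (g (i, true))
        (h.outer_injective.ne (hXY _)) ?_ ?_
      · rw [hgτ]; exact hXw _
      · rw [hgτ]; exact hYw _
  refine ⟨k, hk, h.iso_triangleNecklace hconn hcubic (f := f) ?_
    (fun i b c d => (htri i b c).trans (htri i b d).symm) (fun i => rfl) (fun i => rfl)
    (fun i => congrArg Subtype.val (hgσ i))⟩
  rintro ⟨i, b, c⟩ ⟨j, b', d⟩ hcd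
  have h1 : tri (g (i, b) : V) = tri (g (j, b')) := by rw [← htri i b c, ← htri j b' d, hcd]
  have h2 := hg (Subtype.ext (huniq _ (g (i, b)).2 _ (g (j, b')).2 h1))
  simp only [Prod.mk.injEq] at h2
  obtain ⟨rfl, rfl⟩ := h2
  rw [hinj i b hcd]

lemma exists_iso (h : TrianglePartition G tri σ) (hconn : G.Connected)
    (hcubic : G.IsRegularOfDegree 3) (hγ : dominationNumber G = G.indepNum) :
    ∃ k : ℕ, 1 ≤ k ∧ Nonempty (G ≃g triangleNecklace k) := by
  by_cases hprism : ∃ x y z, x ≠ y ∧ x ≠ z ∧ y ≠ z ∧ tri y = tri x ∧ tri z = tri x ∧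
      tri (σ y) = tri (σ x) ∧ tri (σ z) = tri (σ x)
  · obtain ⟨x, y, z, hxy, hxz, hyz, hy, hz, hσy, hσz⟩ := hprism
    exact ⟨1, le_rfl, h.iso_prism hconn hcubic hxy hxz hyz hy hz hσy hσz⟩
  · exact h.exists_iso_of_double hconn hcubic (h.exists_double hγ)
      fun x y z hxy hxz hyz hy hz hσy hσz =>
        hprism ⟨x, y, z, hxy, hxz, hyz, hy, hz, hσy, hσz⟩

end TrianglePartition

end ClawFreeCubic

theorem mainTheorem7 {V : Type*} [Fintype V] (G : SimpleGraph V) [DecidableRel G.Adj]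
    (hconn : G.Connected) (hcubic : G.IsRegularOfDegree 3) (hclaw : ClawFreeCubic.ClawFree G) :
    ClawFreeCubic.dominationNumber G ≤ G.indepNum ∧
      (ClawFreeCubic.dominationNumber G = G.indepNum ↔
        Nonempty (G ≃g SimpleGraph.completeGraph (Fin 4)) ∨
          ∃ k : ℕ, 1 ≤ k ∧ Nonempty (G ≃g ClawFreeCubic.triangleNecklace k)) := by
  refine ⟨ClawFreeCubic.dominationNumber_le_indepNum G, fun hγ => ?_, ?_⟩
  · refine or_iff_not_imp_left.2 fun hK => ?_
    obtain ⟨tri, σ, h⟩ := ClawFreeCubic.exists_trianglePartition hconn hcubic hclaw hγ hK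
    exact h.exists_iso hconn hcubic hγ
  · rintro (⟨⟨e⟩⟩ | ⟨k, hk, ⟨e⟩⟩)
    · exact ClawFreeCubic.dominationNumber_eq_of_iso_complete e
    · exact ClawFreeCubic.dominationNumber_eq_of_iso_triangleNecklace hk e
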